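/- Let $\mathbb K\in\{\mathbb R,\mathbb C\}$, let $\Omega\subset\mathbb R^d$ be open and non-empty, and let $\mathcal D(\Omega)$ and $\mathcal D'(\Omega)$ be the spaces of $\mathbb K$-valued test functions and of distributions on $\Omega$. Write $xy=(x_1y_1,\dots,x_dy_d)$, $(\mathbb R\setminus\{0\})^d$ for the set of points with all coordinates non-zero, $\tilde\Omega=\bigcup_{a\in(\mathbb R\setminus\{0\})^d}a\Omega$, and $W_\varepsilon=\{x\in\mathbb R^d:\min_j|x_j|\ge\varepsilon\}$ for $\varepsilon>0$. Let $L$ be a Hadamard operator on $\mathcal D'(\Omega)$, that is, a continuous linear operator on $\mathcal D'(\Omega)$ for which every monomial $x^\alpha$, $\alpha\in\mathbb N_0^d$, is an eigenvector, and let $m_\alpha$ be the eigenvalues. Then $L$ has a transpose $M$, that is, a continuous linear operator $M$ on $\mathcal D(\Omega)$ with $(LS)(\varphi)=S(M\varphi)$ for all $S\in\mathcal D'(\Omega)$ and $\varphi\in\mathcal D(\Omega)$. For every $\varphi\in\mathcal D(\tilde\Omega)$ there is exactly one $\psi\in\mathcal D(\mathbb R^d)$ such that $$\int\xi^\alpha\,(m_\alpha\varphi(\xi)-\psi(\xi))\,d\xi=0\quad\text{for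 all }\alpha\in\mathbb N_0^d,$$ and, with $\tilde M\varphi:=\psi$, $\tilde M$ is a continuous linear operator on $\mathcal D(\tilde\Omega)$ that extends $M$. Moreover, there are a distribution $T\in\mathcal D'(\tilde\Omega)$ and an $\varepsilon>0$ with $\operatorname{supp}T\subset W_\varepsilon$ such that $$(\tilde M\varphi)(y)=T_x\varphi(xy)\quad\text{for all }\varphi\in\mathcal D(\tilde\Omega)\text{ and }y\in(\mathbb R\setminus\{0\})^d.$$ This holds, in particular, for $\varphi\in\mathcal D((\mathbb R\setminus\{0\})^d)$ (one has $(\mathbb R\setminus\{0\})^d\subset\tilde\Omega$) and for $\varphi\in\mathcal D(\Omega)$. In the latter case this means $(M\varphi)(y)=T_x\varphi(xy)$ for all $y\in(\mathbb R\setminus\{0\})^d$. -/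

import Mathlib

open MeasureTheory TopologicalSpace
open scoped Distributions CompactConvergenceCLM

noncomputable section

namespace Hadamard

/-- The space `𝓓'(Ω)` of distributions on the open set `Ω ⊆ ℝ^d`, with scalars `𝕜` (`ℝ` or `ℂ`):
the dual of the LF-space `𝓓(Ω)` of `𝕜`-valued test functions. It carries the topology of uniform
convergence on compact subsets of `𝓓(Ω)`, which is the strong dual topology, because `𝓓(Ω)` is a
Montel space. -/
abbrev Distr (𝕜 : Type*) [RCLike 𝕜] {d : ℕ} (Ω : Opens (Fin d → ℝ)) : Type _ :=
  𝓓(Ω, 𝕜) →L_c[𝕜] 𝕜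

/-- The monomial `x ↦ x^α = x_1^{α_1} ⋯ x_d^{α_d}`. -/
def monomial (𝕜 : Type*) [RCLike 𝕜] {d : ℕ} (α : Fin d → ℕ) (x : Fin d → ℝ) : 𝕜 :=
  ((∏ j, x j ^ α j : ℝ) : 𝕜)

theorem continuous_monomial (𝕜 : Type*) [RCLike 𝕜] {d : ℕ} (α : Fin d → ℕ) :
    Continuous (monomial 𝕜 α) := by
  unfold monomial
  exact RCLike.continuous_ofReal.comp (by fun_prop)

/-- The monomial `x^α` as a distribution on `Ω`, that is, `φ ↦ ∫ φ(x) x^α dx`. -/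
def monomialDistr (𝕜 : Type*) [RCLike 𝕜] {d : ℕ} (Ω : Opens (Fin d → ℝ)) (α : Fin d → ℕ) :
    Distr 𝕜 Ω :=
  UniformConvergenceCLM.ofFun (RingHom.id 𝕜) 𝕜 _
    (TestFunction.integralAgainstBilinCLM (ContinuousLinearMap.mul 𝕜 𝕜) volume (monomial 𝕜 α))

theorem monomialDistr_apply (𝕜 : Type*) [RCLike 𝕜] {d : ℕ} (Ω : Opens (Fin d → ℝ))
    (α : Fin d → ℕ) (φ : 𝓓(Ω, 𝕜)) :
    monomialDistr 𝕜 Ω α φ = ∫ x, φ x * monomial 𝕜 α x :=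
  TestFunction.integralAgainstBilinCLM_eq_integral
    (((continuous_monomial 𝕜 α).locallyIntegrable).locallyIntegrableOn _)

/-- `L ∈ L(𝓓'(Ω))` is a Hadamard operator with eigenvalues `m`: every monomial `x^α` is an
eigenvector of `L`, with eigenvalue `m α`. -/
def IsHadamardOperator {𝕜 : Type*} [RCLike 𝕜] {d : ℕ} {Ω : Opens (Fin d → ℝ)}
    (L : Distr 𝕜 Ω →L[𝕜] Distr 𝕜 Ω) (m : (Fin d → ℕ) → 𝕜) : Prop :=
  ∀ α : Fin d → ℕ,
    Module.End.HasEigenvector (L : Distr 𝕜 Ω →ₗ[𝕜] Distr 𝕜 Ω) (m α) (monomialDistr 𝕜 Ω α)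

/-- `M ∈ L(𝓓(Ω))` is the transpose `L^*` of `L ∈ L(𝓓'(Ω))`. There is at most one such `M`. -/
def IsTranspose {𝕜 : Type*} [RCLike 𝕜] {d : ℕ} {Ω : Opens (Fin d → ℝ)}
    (L : Distr 𝕜 Ω →L[𝕜] Distr 𝕜 Ω) (M : 𝓓(Ω, 𝕜) →L[𝕜] 𝓓(Ω, 𝕜)) : Prop :=
  ∀ (S : Distr 𝕜 Ω) (φ : 𝓓(Ω, 𝕜)), L S φ = S (M φ)

/-- The dilation-invariant hull `⋃ a Ω` of `Ω`, the union over all `a ∈ (ℝ∖{0})^d`. -/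
def dilationHull {d : ℕ} (Ω : Opens (Fin d → ℝ)) : Opens (Fin d → ℝ) where
  carrier := ⋃ a ∈ {a : Fin d → ℝ | ∀ j, a j ≠ 0}, (fun x => a * x) '' (Ω : Set (Fin d → ℝ))
  is_open' := by
    refine isOpen_biUnion fun a ha => ?_
    have hu : IsUnit a := Pi.isUnit_iff.2 fun j => (ha j).isUnit
    obtain ⟨u, rfl⟩ := hu
    exact (Homeomorph.mk (Units.mulLeft u) (by simp only [Units.mulLeft]; fun_prop)
      (by simp only [Units.mulLeft]; fun_prop)).isOpenMap _ Ω.isOpen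

theorem mem_dilationHull {d : ℕ} {Ω : Opens (Fin d → ℝ)} {x : Fin d → ℝ} :
    x ∈ dilationHull Ω ↔ ∃ a : Fin d → ℝ, (∀ j, a j ≠ 0) ∧ ∃ z ∈ Ω, a * z = x := by
  change x ∈ ⋃ a ∈ {a : Fin d → ℝ | ∀ j, a j ≠ 0}, _ ↔ _
  simp

theorem le_dilationHull {d : ℕ} (Ω : Opens (Fin d → ℝ)) : Ω ≤ dilationHull Ω := fun x hx =>
  mem_dilationHull.2 ⟨1, fun _ => one_ne_zero, x, hx, one_mul x⟩

/-- The open set `(ℝ∖{0})^d`. -/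
def nonzeroCoords (d : ℕ) : Opens (Fin d → ℝ) where
  carrier := {x | ∀ j, x j ≠ 0}
  is_open' := by
    simp only [Set.ofPred_forall]
    exact isOpen_iInter_of_finite fun j => isOpen_ne_fun (continuous_apply j) continuous_const

/-- The set `W_ε` of all `x` with `min_j |x_j| ≥ ε`. -/
def W (d : ℕ) (ε : ℝ) : Set (Fin d → ℝ) := {x | ∀ j, ε ≤ |x j|}

/-- The inclusion `𝓓(Ω₁) ⊆ 𝓓(Ω₂)` for `Ω₁ ⊆ Ω₂`. -/
def incl {𝕜 : Type*} [RCLike 𝕜] {d : ℕ} {Ω₁ Ω₂ : Opens (Fin d → ℝ)} (h : Ω₁ ≤ Ω₂)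
    (φ : 𝓓(Ω₁, 𝕜)) : 𝓓(Ω₂, 𝕜) where
  toFun := φ
  contDiff' := φ.contDiff
  hasCompactSupport' := φ.hasCompactSupport
  tsupport_subset' := φ.tsupport_subset.trans h

/-- For `y ∈ (ℝ∖{0})^d` and a test function `φ` on the dilation-invariant hull of `Ω`, the test
function `x ↦ φ(xy)`. -/
def dilate {𝕜 : Type*} [RCLike 𝕜] {d : ℕ} {Ω : Opens (Fin d → ℝ)} (y : Fin d → ℝ)
    (hy : ∀ j, y j ≠ 0) (φ : 𝓓(dilationHull Ω, 𝕜)) : 𝓓(dilationHull Ω, 𝕜) where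
  toFun x := φ (x * y)
  contDiff' := φ.contDiff.comp (by fun_prop)
  hasCompactSupport' := by
    obtain ⟨u, rfl⟩ : IsUnit y := Pi.isUnit_iff.2 fun j => (hy j).isUnit
    exact φ.hasCompactSupport.comp_homeomorph
      (Homeomorph.mk (Units.mulRight u) (by simp only [Units.mulRight]; fun_prop)
        (by simp only [Units.mulRight]; fun_prop))
  tsupport_subset' := by
    intro x hx
    have h1 : x * y ∈ tsupport φ :=
      tsupport_comp_subset_preimage φ (f := fun x : Fin d → ℝ => x * y) (by fun_prop) hx
    obtain ⟨a, ha, z, hz, haz⟩ := mem_dilationHull.1 (φ.tsupport_subset h1)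
    refine mem_dilationHull.2 ⟨a * y⁻¹, fun j => mul_ne_zero (ha j) (inv_ne_zero (hy j)), z, hz, ?_⟩
    funext j
    have := congrFun haz j
    simp only [Pi.mul_apply, Pi.inv_apply] at this ⊢
    field_simp [hy j]
    linarith

/-- The graph of the maximal operator attached to a family `m`: all pairs `(φ, ψ)` of test
functions on `ℝ^d` with `∫ ξ^α (m_α φ(ξ) - ψ(ξ)) dξ = 0` for all multi-indices `α`. -/
def momentGraph {𝕜 : Type*} [RCLike 𝕜] {d : ℕ} (m : (Fin d → ℕ) → 𝕜) :
    Set (𝓓((⊤ : Opens (Fin d → ℝ)), 𝕜) × 𝓓((⊤ : Opens (Fin d → ℝ)), 𝕜)) :=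
  {p | ∀ α : Fin d → ℕ, ∫ ξ, monomial 𝕜 α ξ * (m α * p.1 ξ - p.2 ξ) = 0}

end Hadamard

end

/-!
The moments of a compactly supported continuous function determine it, by the Stone–Weierstrass
theorem. Pairing the transpose `M` with monomials therefore characterizes it by the moment
relation, and this relation is compatible with all dilations; a partition of unity on
`dilationHull Ω` whose pieces can be dilated into `Ω` then extends `M` to an operator `Mt` which
commutes with dilations, so that `Mt` is represented by `T φ = Mt φ 1`. The transpose itself is
`M φ y = L δ_y φ`; it exists because `𝓓(Ω)` is the dual of `𝓓'(Ω)`.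

For the support of `T`: a compact subset `C` of `Ω` has a radius `R` such that `M φ` is supported
in the ball of radius `R` whenever `φ` is supported in `C`. Hence `T` vanishes on `a⁻¹ C` for every
dilation `a` of norm larger than `R`, and every point near a coordinate hyperplane lies in such a
set.
-/

noncomputable section

open Filter Topology Set
open scoped ContDiff Manifold Pointwise

namespace Hadamard

section Completeness

variable {E F : Type*} [NormedAddCommGroup E] [NormedSpace ℝ E]
  [NormedAddCommGroup F] [NormedSpace ℝ F] {K : Compacts E}
  {ι : Type*} {l : Filter ι} [l.NeBot] {u : ι → 𝓓_{K}(E, F)}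
  {g : ∀ i : ℕ, BoundedContinuousFunction E (E [×i]→L[ℝ] F)}

theorem hasFTaylorSeriesUpTo_of_tendsto_structureMapCLM
    (hg : ∀ i, Tendsto (fun n ↦ ContDiffMapSupportedIn.structureMapCLM ℝ ⊤ i (u n)) l (𝓝 (g i))) :
    HasFTaylorSeriesUpTo (⊤ : ℕ∞) (fun x ↦ (g 0 x).curry0) (fun x i ↦ g i x) := by
  have hunif : ∀ i, TendstoUniformly (fun n ↦ iteratedFDeriv ℝ i (u n)) (g i) l := fun i ↦ by
    simpa [ContDiffMapSupportedIn.structureMapCLM_top_apply]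
      using! BoundedContinuousFunction.tendsto_iff_tendstoUniformly.1 (hg i)
  refine (hasFTaylorSeriesUpTo_top_iff' le_rfl).2 ⟨fun x ↦ rfl, fun i x ↦ ?_⟩
  refine hasFDerivAt_of_tendstoUniformly (f := fun n ↦ iteratedFDeriv ℝ i (u n))
    (f' := fun n x ↦ (iteratedFDeriv ℝ (i + 1) (u n) x).curryLeft)
    (g' := fun x ↦ (g (i + 1) x).curryLeft) ?_ (fun n y ↦ ?_) (fun x ↦ (hunif i).tendsto_at x) x
  · exact (continuousMultilinearCurryLeftEquiv ℝ (fun _ : Fin (i + 1) ↦ E)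
      F).isometry.uniformContinuous.comp_tendstoUniformly (hunif (i + 1))
  · have h := ((u n).contDiff.differentiable_iteratedFDeriv (m := i)
      (by exact_mod_cast ENat.natCast_lt_top i) y).hasFDerivAt
    rwa [fderiv_iteratedFDeriv] at h

theorem exists_structureMapCLM_eq_of_tendsto
    (hg : ∀ i, Tendsto (fun n ↦ ContDiffMapSupportedIn.structureMapCLM ℝ ⊤ i (u n)) l (𝓝 (g i))) :
    ∃ f : 𝓓_{K}(E, F), ∀ i, ContDiffMapSupportedIn.structureMapCLM ℝ ⊤ i f = g i := by
  have hT := hasFTaylorSeriesUpTo_of_tendsto_structureMapCLM hg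
  refine ⟨⟨fun x ↦ (g 0 x).curry0, hT.contDiff, fun x hx ↦ ?_⟩, fun i ↦ ?_⟩
  · have hlim := (BoundedContinuousFunction.tendsto_iff_tendstoUniformly.1 (hg 0)).tendsto_at x
    simp only [ContDiffMapSupportedIn.structureMapCLM_top_apply,
      (u _).iteratedFDeriv_zero_on_compl hx, Pi.zero_apply] at hlim
    simp [← tendsto_nhds_unique tendsto_const_nhds hlim]
  · ext1 x
    rw [ContDiffMapSupportedIn.structureMapCLM_top_apply]
    exact (hT.eq_iteratedFDeriv (m := i) (WithTop.coe_le_coe.2 le_top) x).symm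

instance completeSpace_contDiffMapSupportedIn [CompleteSpace F] : CompleteSpace 𝓓_{K}(E, F) := by
  have hemb := ContDiffMapSupportedIn.isUniformEmbedding_pi_structureMapCLM (𝕜 := ℝ) (n := ⊤)
    (E := E) (F := F) (K := K)
  refine (completeSpace_iff_isComplete_range hemb.isUniformInducing).2 (IsClosed.isComplete ?_)
  refine isClosed_of_closure_subset fun g hg ↦ ?_
  let Φ : 𝓓_{K}(E, F) → ∀ i, BoundedContinuousFunction E (E [×i]→L[ℝ] F) := fun f i ↦
    ContDiffMapSupportedIn.structureMapCLM ℝ ⊤ i f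
  have : (comap Φ (𝓝 g)).NeBot := comap_neBot_iff_frequently.2 (mem_closure_iff_frequently.1 hg)
  obtain ⟨f, hf⟩ := exists_structureMapCLM_eq_of_tendsto
    (tendsto_pi_nhds.1 (tendsto_comap (f := Φ) (x := 𝓝 g)))
  exact ⟨f, funext hf⟩

instance isCountablyGenerated_uniformity_contDiffMapSupportedIn :
    (uniformity 𝓓_{K}(E, F)).IsCountablyGenerated :=
  (ContDiffMapSupportedIn.isUniformEmbedding_pi_structureMapCLM (𝕜 := ℝ) (n := ⊤) (E := E)
    (F := F) (K := K)).isUniformInducing.comap_uniformity ▸ inferInstance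

instance baireSpace_contDiffMapSupportedIn [CompleteSpace F] : BaireSpace 𝓓_{K}(E, F) :=
  letI := UniformSpace.pseudoMetricSpace 𝓓_{K}(E, F)
  have : IsCompletelyPseudoMetrizableSpace 𝓓_{K}(E, F) := inferInstance
  BaireSpace.of_completelyPseudoMetrizable

end Completeness

section LocallyConvex

variable {𝕜 X : Type*} [RCLike 𝕜] [AddCommGroup X] [Module 𝕜 X] [Module ℝ X]
  [IsScalarTower ℝ 𝕜 X]

theorem balanced_convexHull {B : Set X} (hB : Balanced 𝕜 B) : Balanced 𝕜 (convexHull ℝ B) := by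
  intro c hc
  calc c • convexHull ℝ B = convexHull ℝ (c • B) :=
        ((c • (LinearMap.id : X →ₗ[𝕜] X)).restrictScalars ℝ).image_convexHull B
    _ ⊆ convexHull ℝ B := convexHull_mono (hB c hc)

theorem exists_isCompact_convex_balanced_superset [UniformSpace X] [IsUniformAddGroup X]
    [ContinuousSMul 𝕜 X] [LocallyConvexSpace ℝ X] [QuasiCompleteSpace 𝕜 X] {C : Set X}
    (hC : IsCompact C) : ∃ A, IsCompact A ∧ Convex ℝ A ∧ Balanced 𝕜 A ∧ C ⊆ A := by
  have : ContinuousSMul ℝ X := IsScalarTower.continuousSMul 𝕜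
  have hcomp : IsCompact (Metric.closedBall (0 : 𝕜) 1 • C) := (isCompact_closedBall 0 1).smul_set hC
  have hbal : Balanced 𝕜 (Metric.closedBall (0 : 𝕜) 1 • C) := by
    rintro c hc _ ⟨_, ⟨b, hb, x, hx, rfl⟩, rfl⟩
    refine ⟨c * b, ?_, x, hx, mul_smul c b x⟩
    simpa using mul_le_one₀ hc (norm_nonneg b) (mem_closedBall_zero_iff.1 hb)
  refine ⟨closure (convexHull ℝ (Metric.closedBall (0 : 𝕜) 1 • C)),
    isCompact_closure_of_totallyBounded_quasiComplete (𝕜 := 𝕜)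
      (totallyBounded_convexHull.2 hcomp.totallyBounded),
    (convex_convexHull ℝ _).closure, (balanced_convexHull hbal).closure, fun x hx ↦ ?_⟩
  exact subset_closure (subset_convexHull ℝ _ ⟨1, by simp, x, hx, one_smul 𝕜 x⟩)

theorem exists_separating_of_forall_exists_ne [TopologicalSpace X]
    (Φ : Module.Dual 𝕜 (X →L[𝕜] 𝕜)) {A : Set X} (hA : IsCompact A) (hAc : Convex ℝ A)
    (hΦ : ∀ x ∈ A, ∃ S : X →L[𝕜] 𝕜, Φ S ≠ S x) :
    ∃ (S : X →L[𝕜] 𝕜) (u : ℝ), (∀ a ∈ A, RCLike.re (S a) < u) ∧ u < RCLike.re (Φ S) := by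
  let P : Module.Dual 𝕜 (X →L[𝕜] 𝕜) →ₗ[𝕜] Module.Dual 𝕜 (X →L[𝕜] 𝕜) := LinearMap.id
  let J : X →ₗ[𝕜] WeakBilin P := (ContinuousLinearMap.coeLM 𝕜 : (X →L[𝕜] 𝕜) →ₗ[𝕜] X →ₗ[𝕜] 𝕜).flip
  have hJ : Continuous J := WeakBilin.continuous_of_continuous_eval P fun S ↦ S.continuous
  have : T2Space (WeakBilin P) := (WeakBilin.isEmbedding (B := P) fun _ _ h ↦ h).t2Space
  have hJA : IsClosed (J '' A) := (hA.image hJ).isClosed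
  have hJc : Convex ℝ (J '' A) := hAc.linear_image (J.restrictScalars ℝ)
  let Ψ : WeakBilin P := Φ
  have hΨ : Ψ ∉ J '' A := by
    rintro ⟨x, hx, hxΨ⟩
    obtain ⟨S, hS⟩ := hΦ x hx
    exact hS (LinearMap.congr_fun hxΨ S).symm
  obtain ⟨f, u, hfA, hfu⟩ := RCLike.geometric_hahn_banach_closed_point (𝕜 := 𝕜) hJc hJA hΨ
  obtain ⟨S, rfl⟩ := P.dualEmbedding_surjective f
  exact ⟨S, u, fun a ha ↦ hfA (J a) (mem_image_of_mem J ha), hfu⟩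

/-- The bipolar theorem for `A`: being compact, `A` is already closed in the algebraic dual of
`X →L[𝕜] 𝕜`. -/
theorem exists_mem_forall_eq_apply [TopologicalSpace X] (Φ : Module.Dual 𝕜 (X →L[𝕜] 𝕜))
    {A : Set X} (hA : IsCompact A) (hAc : Convex ℝ A) (hAb : Balanced 𝕜 A) (hne : A.Nonempty)
    (hΦ : ∀ S : X →L[𝕜] 𝕜, (∀ a ∈ A, ‖S a‖ ≤ 1) → ‖Φ S‖ ≤ 1) :
    ∃ x ∈ A, ∀ S : X →L[𝕜] 𝕜, Φ S = S x := by
  by_contra! hmem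
  obtain ⟨S, u, hre, hΦu⟩ := exists_separating_of_forall_exists_ne Φ hA hAc hmem
  have hu : 0 < u := by simpa using hre 0 (hAb.zero_mem hne)
  have hnorm : ∀ a ∈ A, ‖S a‖ ≤ u := fun a ha ↦ by
    obtain ⟨c, hc, hca⟩ := RCLike.exists_norm_eq_mul_self (S a)
    have := hre (c • a) (hAb.smul_mem hc.le ha)
    rw [map_smul, smul_eq_mul, ← hca, RCLike.ofReal_re] at this
    exact this.le
  have hu' : ‖(u : 𝕜)⁻¹‖ = u⁻¹ := by rw [norm_inv, RCLike.norm_ofReal, abs_of_pos hu]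
  have hΦS : ‖Φ ((u : 𝕜)⁻¹ • S)‖ ≤ 1 := hΦ _ fun a ha ↦ by
    calc ‖(u : 𝕜)⁻¹ * S a‖ = u⁻¹ * ‖S a‖ := by rw [norm_mul, hu']
      _ ≤ 1 := (inv_mul_le_one₀ hu).2 (hnorm a ha)
  rw [map_smul, norm_smul, hu', inv_mul_le_one₀ hu] at hΦS
  exact absurd ((RCLike.re_le_norm (Φ S)).trans hΦS) (not_le.2 hΦu)

/-- The part of the Mackey–Arens theorem that makes the transpose of `L` act on test functions. -/
theorem exists_forall_eq_apply_of_compactConvergence [TopologicalSpace X]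
    (hX : ∀ C : Set X, IsCompact C → ∃ A, IsCompact A ∧ Convex ℝ A ∧ Balanced 𝕜 A ∧ C ⊆ A)
    (Φ : (X →L_c[𝕜] 𝕜) →L[𝕜] 𝕜) : ∃ x : X, ∀ S : X →L_c[𝕜] 𝕜, Φ S = S x := by
  have hball : Φ ⁻¹' Metric.ball 0 1 ∈ 𝓝 (0 : X →L_c[𝕜] 𝕜) :=
    Φ.continuous.continuousAt.preimage_mem_nhds (by simpa using Metric.ball_mem_nhds 0 one_pos)
  obtain ⟨⟨C, r⟩, ⟨hC : IsCompact C, hr : 0 < r⟩, hCr⟩ :=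
    (CompactConvergenceCLM.hasBasis_nhds_zero_of_basis (σ := RingHom.id 𝕜) (E := X)
      Metric.nhds_basis_ball).mem_iff.1 hball
  obtain ⟨A, hA, hAc, hAb, hCA⟩ := hX (insert 0 C) (hC.insert 0)
  let Φ' : Module.Dual 𝕜 (X →L[𝕜] 𝕜) := ((r / 2 : ℝ) : 𝕜) • Φ.toLinearMap
  have hbound (S : X →L[𝕜] 𝕜) (hS : ∀ a ∈ A, ‖S a‖ ≤ 1) : ‖Φ' S‖ ≤ 1 := by
    let S' : X →L_c[𝕜] 𝕜 := UniformConvergenceCLM.ofFun (RingHom.id 𝕜) 𝕜 _ S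
    have hmem : ((r / 2 : ℝ) : 𝕜) • S' ∈ Φ ⁻¹' Metric.ball 0 1 := hCr fun a ha ↦ by
      have ha1 : ‖S a‖ ≤ 1 := hS a (hCA (mem_insert_of_mem 0 ha))
      rw [mem_ball_zero_iff]
      calc ‖((r / 2 : ℝ) : 𝕜) * S a‖ = r / 2 * ‖S a‖ := by
            rw [norm_mul, RCLike.norm_ofReal, abs_of_pos (half_pos hr)]
        _ ≤ r / 2 := mul_le_of_le_one_right (half_pos hr).le ha1
        _ < r := half_lt_self hr
    rw [mem_preimage, mem_ball_zero_iff, map_smul] at hmem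
    exact hmem.le
  obtain ⟨x, -, hx⟩ :=
    exists_mem_forall_eq_apply Φ' hA hAc hAb ⟨0, hCA (mem_insert 0 C)⟩ hbound
  refine ⟨((r / 2 : ℝ) : 𝕜)⁻¹ • x, fun S ↦ ?_⟩
  rw [map_smul]
  exact (eq_inv_smul_iff₀ (RCLike.ofReal_ne_zero.2 (half_pos hr).ne')).2 (hx S)

/-- The closed balls of a continuous seminorm `p` are weakly closed, so `p ∘ N` is lower
semicontinuous; in a barrelled space such a seminorm is continuous. -/
theorem continuous_of_forall_dual_comp {Y : Type*} [TopologicalSpace X] [IsTopologicalAddGroup X]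
    [BarrelledSpace ℝ X] [AddCommGroup Y] [Module 𝕜 Y] [Module ℝ Y]
    [IsScalarTower ℝ 𝕜 Y] [TopologicalSpace Y] [IsTopologicalAddGroup Y] [ContinuousSMul 𝕜 Y]
    [LocallyConvexSpace ℝ Y] (N : X →ₗ[𝕜] Y) (hN : ∀ S : Y →L[𝕜] 𝕜, Continuous fun x ↦ S (N x)) :
    Continuous N := by
  have : ContinuousSMul ℝ Y := IsScalarTower.continuousSMul 𝕜
  refine (with_gaugeSeminormFamily (𝕜 := ℝ) (E := Y)).continuous_of_continuous_comp
    (N.restrictScalars ℝ) fun i ↦ Seminorm.continuous_of_lowerSemicontinuous _ ?_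
  set p := gaugeSeminormFamily ℝ Y i
  have hclosed (r : ℝ) : IsClosed {y | p y ≤ r} :=
    isClosed_le ((with_gaugeSeminormFamily (𝕜 := ℝ) (E := Y)).continuous_seminorm i)
      continuous_const
  have hconvex (r : ℝ) : Convex ℝ {y | p y ≤ r} := by
    simpa [Seminorm.closedBall_zero_eq] using p.convex_closedBall 0 r
  refine lowerSemicontinuous_iff_isClosed_preimage.2 fun r ↦ ?_
  refine isOpen_compl_iff.1 (isOpen_iff_mem_nhds.2 fun x hx ↦ ?_)
  obtain ⟨S, u, hS, hSu⟩ :=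
    RCLike.geometric_hahn_banach_closed_point (𝕜 := 𝕜) (x := N x) (hconvex r) (hclosed r) hx
  have hre : Continuous fun z ↦ RCLike.re (S (N z)) := RCLike.continuous_re.comp (hN S)
  filter_upwards [hre.continuousAt.preimage_mem_nhds (Ioi_mem_nhds hSu)] with z hz hzr
  exact lt_asymm hz (hS _ hzr)

end LocallyConvex

theorem exists_compacts_exhaustion {E : Type*} [TopologicalSpace E] [LocallyCompactSpace E]
    [SecondCountableTopology E] (Ω : Opens E) :
    ∃ K : ℕ → Compacts E, (∀ n, (K n : Set E) ⊆ Ω) ∧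
      ∀ s : Set E, IsCompact s → s ⊆ Ω → ∃ N, ∀ n ≥ N, s ⊆ K n := by
  have : LocallyCompactSpace Ω := Ω.isOpen.locallyCompactSpace
  let c : CompactExhaustion Ω := default
  refine ⟨fun n ↦ ⟨Subtype.val '' c n, (c.isCompact n).image continuous_subtype_val⟩,
    fun n ↦ Subtype.coe_image_subset _ _, fun s hs hsΩ ↦ ?_⟩
  obtain ⟨N, hN⟩ := c.exists_superset_of_isCompact
    (IsInducing.subtypeVal.isCompact_preimage_iff (by simpa using hsΩ) |>.2 hs)
  exact ⟨N, fun n hn x hx ↦ ⟨⟨x, hsΩ hx⟩, c.subset hn (hN hx), rfl⟩⟩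

theorem norm_smul_apply_le_sum_mul {E F : Type*} [NormedAddCommGroup F] [NormedSpace ℝ F]
    {x : ℕ → E} (c : ℕ → ℝ) {f : E → F} {N : ℕ} {C : ℝ}
    (hN : ∀ n ≥ N, f (x n) = 0) (hC : ∀ y, ‖f y‖ ≤ C) (n : ℕ) :
    ‖c n • f (x n)‖ ≤ (∑ i ∈ Finset.range N, ‖c i‖) * C := by
  have hC0 : 0 ≤ C := (norm_nonneg _).trans (hC (x n))
  rcases lt_or_ge n N with hn | hn
  · rw [norm_smul]
    gcongr
    · exact Finset.single_le_sum (f := fun i ↦ ‖c i‖) (fun _ _ ↦ norm_nonneg _)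
        (Finset.mem_range.2 hn)
    · exact hC _
  · rw [hN n hn, smul_zero, norm_zero]
    positivity

section CommonSupport

variable {E F : Type*} [NormedAddCommGroup E] [NormedSpace ℝ E]
  [NormedAddCommGroup F] [NormedSpace ℝ F] {Ω : Opens E}

theorem exists_weightedEval {x : ℕ → E} (c : ℕ → ℝ)
    (hx : ∀ K : Set E, IsCompact K → K ⊆ Ω → ∃ N, ∀ n ≥ N, x n ∉ K) :
    ∃ Λ : 𝓓(Ω, F) →L[ℝ] BoundedContinuousFunction ℕ F, ∀ f n, Λ f n = c n • f (x n) := by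
  have hbound (f : 𝓓(Ω, F)) : ∃ C, ∀ n, ‖c n • f (x n)‖ ≤ C := by
    obtain ⟨N, hN⟩ := hx _ f.hasCompactSupport f.tsupport_subset
    obtain ⟨C, hC⟩ := f.contDiff.continuous.bounded_above_of_compact_support f.hasCompactSupport
    exact ⟨_, norm_smul_apply_le_sum_mul c
      (fun n hn ↦ image_eq_zero_of_notMem_tsupport (hN n hn)) hC⟩
  let Λ : 𝓓(Ω, F) → BoundedContinuousFunction ℕ F := fun f ↦
    BoundedContinuousFunction.ofNormedAddCommGroup (fun n ↦ c n • f (x n))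
      continuous_of_discreteTopology _ (hbound f).choose_spec
  have hadd (f g) : Λ (f + g) = Λ f + Λ g := by ext n; simp [Λ]
  have hsmul (r : ℝ) (f) : Λ (r • f) = r • Λ f := by ext n; simp [Λ, smul_comm r]
  refine ⟨TestFunction.mkCLM ℝ Λ hadd hsmul fun K hK ↦ ?_, fun f n ↦ rfl⟩
  obtain ⟨N, hN⟩ := hx K K.isCompact hK
  refine (ContDiffMapSupportedIn.mkCLMtoNormedSpace ℝ (Λ ∘ TestFunction.ofSupportedIn hK)
    (fun f g ↦ hadd (.ofSupportedIn hK f) (.ofSupportedIn hK g))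
    (fun r f ↦ hsmul r (.ofSupportedIn hK f))
    ⟨{0}, ∑ i ∈ Finset.range N, ‖c i‖, by positivity, fun f ↦ ?_⟩).continuous
  refine (BoundedContinuousFunction.norm_le (by positivity)).2 fun n ↦ ?_
  rw [Finset.sup_singleton]
  exact norm_smul_apply_le_sum_mul c (fun n hn ↦ f.zero_on_compl (hN n hn))
    (fun y ↦ ContDiffMapSupportedIn.norm_apply_le_seminorm ℝ) n

theorem exists_compacts_tsupport_subset_of_isCompact [FiniteDimensional ℝ E] {S : Set 𝓓(Ω, F)}
    (hS : IsCompact S) : ∃ K : Compacts E, (K : Set E) ⊆ Ω ∧ ∀ f ∈ S, tsupport f ⊆ K := by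
  obtain ⟨K, hKΩ, hK⟩ := exists_compacts_exhaustion Ω
  by_contra! hcon
  have hescape (n) : ∃ f ∈ S, ∃ x ∉ K n, f x ≠ 0 := by
    obtain ⟨f, hf, hfn⟩ := hcon (K n) (hKΩ n)
    contrapose! hfn
    exact closure_minimal (fun x hx ↦ by_contra fun h ↦ hx (hfn f hf x h))
      (K n).isCompact.isClosed
  choose f hf x hxK hfx using hescape
  obtain ⟨Λ, hΛ⟩ : ∃ Λ : 𝓓(Ω, F) →L[ℝ] BoundedContinuousFunction ℕ F,
      ∀ g n, Λ g n = (n / ‖f n (x n)‖ : ℝ) • g (x n) :=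
    exists_weightedEval _ fun s hs hsΩ ↦
      (hK s hs hsΩ).imp fun N hN n hn h ↦ hxK n (hN n hn h)
  obtain ⟨C, hC⟩ := (hS.image Λ.continuous).isBounded.exists_norm_le
  obtain ⟨n, hn⟩ := exists_nat_gt C
  refine hn.not_ge ?_
  calc (n : ℝ) = ‖Λ (f n) n‖ := by
        rw [hΛ, norm_smul, norm_div, norm_norm, div_mul_cancel₀ _ (norm_ne_zero_iff.2 (hfx n)),
          RCLike.norm_natCast]
    _ ≤ ‖Λ (f n)‖ := BoundedContinuousFunction.norm_coe_le_norm _ _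
    _ ≤ C := hC _ (mem_image_of_mem _ (hf n))

theorem exists_compacts_tsupport_subset_of_baireSpace [FiniteDimensional ℝ E] {X : Type*}
    [AddCommGroup X] [Module ℝ X] [TopologicalSpace X] [IsTopologicalAddGroup X]
    [ContinuousSMul ℝ X] [BaireSpace X] (N : X →L[ℝ] 𝓓(Ω, F)) :
    ∃ K : Compacts E, (K : Set E) ⊆ Ω ∧ ∀ f, tsupport (N f) ⊆ K := by
  obtain ⟨K, hKΩ, hK⟩ := exists_compacts_exhaustion Ω
  let V (n : ℕ) : Submodule ℝ X :=
    ⨅ x ∈ (K n : Set E)ᶜ,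
      (ContinuousLinearMap.comp (BoundedContinuousFunction.evalCLM ℝ x)
        ((TestFunction.toBoundedContinuousFunctionCLM ℝ).comp N)).toLinearMap.ker
  have hmem (n f) : f ∈ V n ↔ ∀ x ∉ K n, N f x = 0 := by
    simp [V]
  have hclosed (n) : IsClosed (V n : Set X) := by
    simp only [V, Submodule.coe_iInf]
    exact isClosed_biInter fun x _ ↦ ContinuousLinearMap.isClosed_ker _
  have hunion : ⋃ n, (V n : Set X) = univ := eq_univ_of_forall fun f ↦ by
    obtain ⟨n, hn⟩ := hK _ (N f).hasCompactSupport (N f).tsupport_subset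
    exact mem_iUnion.2 ⟨n, (hmem n f).2 fun x hx ↦
      image_eq_zero_of_notMem_tsupport fun h ↦ hx (hn n le_rfl h)⟩
  obtain ⟨n, hn⟩ := nonempty_interior_of_iUnion_of_closed hclosed hunion
  have htop := (V n).eq_top_of_nonempty_interior' hn
  refine ⟨K n, hKΩ n, fun f ↦ closure_minimal (fun x hx ↦ ?_) (K n).isCompact.isClosed⟩
  by_contra h
  exact hx ((hmem n f).1 (htop ▸ Submodule.mem_top) x h)

end CommonSupport

section Multiplication

variable {𝕜 E : Type*} [RCLike 𝕜] [NormedAddCommGroup E] [NormedSpace ℝ E]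
  {Ω Ω' : Opens E} {K K' : Compacts E}

/-- Restriction of the codomain of an operator on smooth functions with compact support, when all
its values are supported in a smaller compact set. -/
def codRestrictSupport {F : Type*} [NormedAddCommGroup F] [NormedSpace ℝ F] [NormedSpace 𝕜 F]
    [SMulCommClass ℝ 𝕜 F] {X : Type*} [AddCommGroup X] [Module 𝕜 X] [TopologicalSpace X]
    (N : X →L[𝕜] 𝓓_{K}(E, F)) (h : ∀ f, Function.support (N f) ⊆ K') : X →L[𝕜] 𝓓_{K'}(E, F) where
  toFun f := .of_support_subset (N f).contDiff (h f)
  map_add' f g := by ext x; exact DFunLike.congr_fun (map_add N f g) x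
  map_smul' c f := by ext x; exact DFunLike.congr_fun (map_smul N c f) x
  cont := by
    refine (ContDiffMapSupportedIn.continuous_iff_comp _).2 fun i ↦ ?_
    convert (ContDiffMapSupportedIn.continuous_iff_comp _).1 N.continuous i using 1
    ext f x
    simp only [Function.comp_apply, ContDiffMapSupportedIn.structureMapCLM_top_apply]
    rfl

/-- Multiplication by a fixed smooth function `χ` with compact support, as an operator from `𝓓(Ω)`
to the smooth functions supported in a compact set `K'` containing the support of `χ`. -/
def mulSupportedCLM (χ : 𝓓(Ω', 𝕜)) (hχ : tsupport χ ⊆ K') : 𝓓(Ω, 𝕜) →L[𝕜] 𝓓_{K'}(E, 𝕜) :=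
  TestFunction.limitCLM 𝕜
    (fun φ ↦ .of_support_subset (f := fun x ↦ φ x * χ x) (φ.contDiff.mul χ.contDiff)
      (((Function.support_mul_subset_right _ _).trans (subset_tsupport χ)).trans hχ))
    (fun K _ ↦ codRestrictSupport
      (ContDiffMapSupportedIn.bilinLeftCLM (K := K) (ContinuousLinearMap.mul 𝕜 𝕜) χ.contDiff)
      fun _ ↦ ((Function.support_mul_subset_right _ _).trans (subset_tsupport χ)).trans hχ)
    fun _ _ _ ↦ rfl

/-- Multiplication by a test function `χ` on `Ω'`, as an operator from `𝓓(Ω)` to `𝓓(Ω')`. -/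
def mulCLM (χ : 𝓓(Ω', 𝕜)) : 𝓓(Ω, 𝕜) →L[𝕜] 𝓓(Ω', 𝕜) :=
  (TestFunction.ofSupportedInCLM 𝕜 (K := ⟨tsupport χ, χ.hasCompactSupport⟩)
    χ.tsupport_subset).comp (mulSupportedCLM χ subset_rfl)

@[simp]
theorem mulCLM_apply (χ : 𝓓(Ω', 𝕜)) (φ : 𝓓(Ω, 𝕜)) (x : E) : mulCLM χ φ x = φ x * χ x := rfl

theorem exists_testFunction_sum_eq_one [FiniteDimensional ℝ E] {ι : Type*} {K : Set E}
    (hK : IsCompact K) (U : ι → Opens E) (hKU : K ⊆ ⋃ i, U i) :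
    ∃ (t : Finset ι) (χ : ∀ i, 𝓓(U i, 𝕜)), ∀ x ∈ K, ∑ i ∈ t, χ i x = 1 := by
  classical
  obtain ⟨L, hL, hKL⟩ := exists_compact_superset hK
  obtain ⟨t, ht⟩ := hK.elim_finite_subcover (fun i ↦ (U i : Set E)) (fun i ↦ (U i).isOpen) hKU
  obtain ⟨p, hp⟩ := SmoothPartitionOfUnity.exists_isSubordinate 𝓘(ℝ, E) hK.isClosed
    (fun i : t ↦ (U i : Set E) ∩ interior L) (fun i ↦ (U i).isOpen.inter isOpen_interior)
    (by simpa [← iUnion_inter, iUnion_subtype] using ⟨ht, hKL⟩)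
  let χ (i : t) : 𝓓(U i, 𝕜) :=
    { toFun := fun x ↦ (p i x : 𝕜)
      contDiff' := (RCLike.ofRealCLM (K := 𝕜)).contDiff.comp (p i).contMDiff.contDiff
      hasCompactSupport' := HasCompactSupport.comp_left (hL.of_isClosed_subset (isClosed_tsupport _)
        ((hp i).trans (inter_subset_right.trans interior_subset))) RCLike.ofReal_zero
      tsupport_subset' := (tsupport_comp_subset RCLike.ofReal_zero _).trans
        ((hp i).trans inter_subset_left) }
  let χ' (i : ι) : 𝓓(U i, 𝕜) := if h : i ∈ t then χ ⟨i, h⟩ else 0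
  refine ⟨t, χ', fun x hx ↦ ?_⟩
  calc ∑ i ∈ t, χ' i x = ∑ i : t, (p i x : 𝕜) := by
        rw [← Finset.sum_coe_sort t]
        exact Finset.sum_congr rfl fun i _ ↦ by simp only [χ', dif_pos i.2]; rfl
    _ = 1 := by rw [← RCLike.ofReal_sum, ← finsum_eq_sum_of_fintype, p.sum_eq_one hx,
      RCLike.ofReal_one]

theorem exists_testFunction_eq_one [FiniteDimensional ℝ E] {K : Set E} (hK : IsCompact K)
    (hKΩ : K ⊆ Ω) : ∃ χ : 𝓓(Ω, 𝕜), ∀ x ∈ K, χ x = 1 := by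
  obtain ⟨t, χ, hχ⟩ := exists_testFunction_sum_eq_one (𝕜 := 𝕜) hK (fun _ : Unit ↦ Ω)
    (by rwa [iUnion_const])
  exact ⟨∑ i ∈ t, χ i, fun x hx ↦ by simpa using hχ x hx⟩

theorem apply_eq_zero_of_forall_isVanishingOn [FiniteDimensional ℝ E] (T : 𝓓(Ω, 𝕜) →L_c[𝕜] 𝕜)
    {φ : 𝓓(Ω, 𝕜)}
    (h : ∀ x ∈ tsupport φ, ∃ s, IsOpen s ∧ x ∈ s ∧ Distribution.IsVanishingOn T s) : T φ = 0 := by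
  choose s hs hxs hT using h
  let U (x : tsupport φ) : Opens E := ⟨s x x.2, hs x x.2⟩ ⊓ Ω
  obtain ⟨t, χ, hχ⟩ := exists_testFunction_sum_eq_one (𝕜 := 𝕜) φ.hasCompactSupport U fun x hx ↦
    mem_iUnion.2 ⟨⟨x, hx⟩, hxs x hx, φ.tsupport_subset hx⟩
  let ψ (i : tsupport φ) : 𝓓(Ω, 𝕜) := TestFunction.monoCLM 𝕜 (mulCLM (χ i) φ)
  have hψ (i) : (ψ i : E → 𝕜) = mulCLM (χ i) φ := by simp [ψ, U]
  have hsum : φ = ∑ i ∈ t, ψ i := by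
    ext x
    by_cases hx : x ∈ tsupport φ
    · simp [hψ, ← Finset.mul_sum, hχ x hx]
    · simp [hψ, image_eq_zero_of_notMem_tsupport hx]
  have hzero (i) : T (ψ i) = 0 := hT i i.2 (ψ i) <| by
    rw [hψ]
    exact (mulCLM (χ i) φ).tsupport_subset.trans inter_subset_left
  have := map_sum T ψ t
  rw [hsum, this, Finset.sum_eq_zero fun i _ ↦ hzero i]

end Multiplication

section ScalarMultiplication

variable {𝕜 E : Type*} [RCLike 𝕜] [NormedAddCommGroup E] [NormedSpace ℝ E] {Ω : Opens E}

instance continuousConstSMul_testFunction : ContinuousConstSMul 𝕜 𝓓(Ω, 𝕜) where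
  continuous_const_smul c :=
    (TestFunction.postcompCLM (𝕜 := ℝ) (ContinuousLinearMap.lsmul ℝ 𝕜 c : 𝕜 →L[ℝ] 𝕜) :
      𝓓(Ω, 𝕜) →L[ℝ] 𝓓(Ω, 𝕜)).continuous

instance continuousSMul_testFunction : ContinuousSMul 𝕜 𝓓(Ω, 𝕜) where
  continuous_smul := by
    have hsplit (p : 𝕜 × 𝓓(Ω, 𝕜)) :
        p.1 • p.2 = RCLike.re p.1 • p.2 + RCLike.im p.1 • (RCLike.I : 𝕜) • p.2 := by
      ext x
      have h : p.1 = RCLike.re p.1 + RCLike.im p.1 * RCLike.I := (RCLike.re_add_im p.1).symm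
      change p.1 * p.2 x = RCLike.re p.1 • p.2 x + RCLike.im p.1 • (RCLike.I * p.2 x)
      simp only [RCLike.real_smul_eq_coe_mul]
      linear_combination p.2 x * h
    simp only [hsplit]
    fun_prop

theorem exists_isCompact_convex_balanced_superset_testFunction [FiniteDimensional ℝ E]
    {C : Set 𝓓(Ω, 𝕜)} (hC : IsCompact C) :
    ∃ A, IsCompact A ∧ Convex ℝ A ∧ Balanced 𝕜 A ∧ C ⊆ A := by
  obtain ⟨K, hKΩ, hCK⟩ := exists_compacts_tsupport_subset_of_isCompact hC
  obtain ⟨χ, hχ⟩ := exists_testFunction_eq_one (𝕜 := 𝕜) K.isCompact hKΩ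
  let K' : Compacts E := ⟨tsupport χ, χ.hasCompactSupport⟩
  let cut : 𝓓(Ω, 𝕜) →L[𝕜] 𝓓_{K'}(E, 𝕜) := mulSupportedCLM χ subset_rfl
  let ext : 𝓓_{K'}(E, 𝕜) →L[𝕜] 𝓓(Ω, 𝕜) := TestFunction.ofSupportedInCLM 𝕜 χ.tsupport_subset
  have hcut : ∀ f ∈ C, ext (cut f) = f := fun f hf ↦ by
    ext x
    change f x * χ x = f x
    by_cases hx : x ∈ tsupport f
    · rw [hχ x (hCK f hf hx), mul_one]
    · rw [image_eq_zero_of_notMem_tsupport hx, zero_mul]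
  obtain ⟨A, hA, hAc, hAb, hCA⟩ :=
    exists_isCompact_convex_balanced_superset (𝕜 := 𝕜) (hC.image cut.continuous)
  refine ⟨ext '' A, hA.image ext.continuous,
    hAc.linear_image (ext.toLinearMap.restrictScalars ℝ), ?_,
    fun f hf ↦ ⟨cut f, hCA (mem_image_of_mem cut hf), hcut f hf⟩⟩
  rintro c hc _ ⟨_, ⟨f, hf, rfl⟩, rfl⟩
  exact ⟨c • f, hAb.smul_mem hc hf, map_smul ext c f⟩

end ScalarMultiplication

section ChangeOfVariables

variable {𝕜 E E' F : Type*} [RCLike 𝕜] [NormedAddCommGroup E] [NormedSpace ℝ E]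
  [NormedAddCommGroup E'] [NormedSpace ℝ E'] [NormedAddCommGroup F] [NormedSpace ℝ F]
  [NormedSpace 𝕜 F] [SMulCommClass ℝ 𝕜 F]

theorem norm_iteratedFDeriv_comp_continuousLinearMap_le (A : E' →L[ℝ] E) {f : E → F}
    (hf : ContDiff ℝ ∞ f) (i : ℕ) (x : E') :
    ‖iteratedFDeriv ℝ i (fun x ↦ f (A x)) x‖ ≤ ‖A‖ ^ i * ‖iteratedFDeriv ℝ i f (A x)‖ := by
  have h : iteratedFDeriv ℝ i (fun x ↦ f (A x)) x =
      (iteratedFDeriv ℝ i f (A x)).compContinuousLinearMap fun _ ↦ A :=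
    A.iteratedFDeriv_comp_right hf x (i := i) (WithTop.coe_le_coe.2 le_top)
  calc ‖iteratedFDeriv ℝ i (fun x ↦ f (A x)) x‖
      ≤ ‖iteratedFDeriv ℝ i f (A x)‖ * ∏ _ : Fin i, ‖A‖ :=
        h ▸ ContinuousMultilinearMap.norm_compContinuousLinearMap_le _ _
    _ = ‖A‖ ^ i * ‖iteratedFDeriv ℝ i f (A x)‖ := by
        rw [Finset.prod_const, Finset.card_univ, Fintype.card_fin, mul_comm]

/-- Composition with a linear map `A`, as an operator from the smooth functions supported in `K`
to those supported in a compact set containing the preimage of `K`. -/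
def compSupportedCLM (A : E →L[ℝ] E) {K K' : Compacts E} (h : A ⁻¹' K ⊆ K') :
    𝓓_{K}(E, F) →L[𝕜] 𝓓_{K'}(E, F) :=
  ContDiffMapSupportedIn.mkCLM 𝕜 (fun f x ↦ f (A x)) (fun _ _ _ ↦ rfl) (fun _ _ _ ↦ rfl)
    (fun f ↦ f.contDiff.comp A.contDiff)
    (fun f _ hx ↦ f.zero_on_compl fun hA ↦ hx (h hA))
    fun i _ ↦ ⟨{i}, ‖A‖ ^ i, by positivity, fun f x _ ↦ by
      rw [Finset.sup_singleton]
      refine (norm_iteratedFDeriv_comp_continuousLinearMap_le A f.contDiff i x).trans ?_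
      gcongr
      exact ContDiffMapSupportedIn.norm_iteratedFDeriv_apply_le_seminorm_top 𝕜⟩

/-- Composition with a linear isomorphism `A`, as an operator from `𝓓(Ω)` to `𝓓(Ω')`, where `Ω'`
contains the preimage of `Ω`. -/
def compEquivCLM [IsScalarTower ℝ 𝕜 F] {Ω Ω' : Opens E} (A : E ≃L[ℝ] E)
    (h : ∀ x, A x ∈ Ω → x ∈ Ω') : 𝓓(Ω, F) →L[𝕜] 𝓓(Ω', F) :=
  TestFunction.limitCLM 𝕜
    (fun φ ↦
      { toFun x := φ (A x)
        contDiff' := φ.contDiff.comp A.contDiff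
        hasCompactSupport' := φ.hasCompactSupport.comp_homeomorph A.toHomeomorph
        tsupport_subset' x hx := h x
          (φ.tsupport_subset (tsupport_comp_subset_preimage φ A.continuous hx)) })
    (fun K hK ↦ (TestFunction.ofSupportedInCLM 𝕜
      (K := ⟨A ⁻¹' K, A.toHomeomorph.isCompact_preimage.2 K.isCompact⟩)
      fun x hx ↦ h x (hK hx)).comp (compSupportedCLM (A : E →L[ℝ] E) subset_rfl))
    fun _ _ _ ↦ rfl

end ChangeOfVariables

section Dilation

variable {𝕜 : Type*} [RCLike 𝕜] {d : ℕ} {Ω Ω₁ Ω₂ : Opens (Fin d → ℝ)}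

/-- The operator `φ ↦ φ(a ·)` on test functions, for `a ∈ (ℝ∖{0})^d`, that is, for a unit `a` of
the ring `ℝ^d`. -/
def scale (a : (Fin d → ℝ)ˣ) (h : ∀ x, (a : Fin d → ℝ) * x ∈ Ω₁ → x ∈ Ω₂) :
    𝓓(Ω₁, 𝕜) →L[𝕜] 𝓓(Ω₂, 𝕜) :=
  compEquivCLM (ContinuousLinearEquiv.smulLeft a) h

@[simp]
theorem scale_apply (a : (Fin d → ℝ)ˣ) (h : ∀ x, (a : Fin d → ℝ) * x ∈ Ω₁ → x ∈ Ω₂) (φ : 𝓓(Ω₁, 𝕜))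
    (x : Fin d → ℝ) : scale a h φ x = φ (a * x) := rfl

theorem exists_units_coe_eq {y : Fin d → ℝ} (hy : ∀ j, y j ≠ 0) : ∃ a : (Fin d → ℝ)ˣ, ↑a = y :=
  Pi.isUnit_iff.2 fun j ↦ (hy j).isUnit

theorem units_apply_ne_zero (a : (Fin d → ℝ)ˣ) (j : Fin d) : (a : Fin d → ℝ) j ≠ 0 :=
  (Pi.isUnit_iff.1 a.isUnit j).ne_zero

theorem mem_dilationHull_iff_exists_units {x : Fin d → ℝ} :
    x ∈ dilationHull Ω ↔ ∃ a : (Fin d → ℝ)ˣ, ↑a * x ∈ Ω := by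
  rw [mem_dilationHull]
  constructor
  · rintro ⟨a, ha, z, hz, rfl⟩
    obtain ⟨a, rfl⟩ := exists_units_coe_eq ha
    exact ⟨a⁻¹, by rwa [Units.inv_mul_cancel_left]⟩
  · rintro ⟨a, ha⟩
    exact ⟨↑a⁻¹, units_apply_ne_zero _, a * x, ha, Units.inv_mul_cancel_left a x⟩

theorem mem_dilationHull_of_mul_mem (a : (Fin d → ℝ)ˣ) {x : Fin d → ℝ}
    (hx : ↑a * x ∈ dilationHull Ω) : x ∈ dilationHull Ω := by
  obtain ⟨b, hb⟩ := mem_dilationHull_iff_exists_units.1 hx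
  exact mem_dilationHull_iff_exists_units.2 ⟨b * a, by rwa [Units.val_mul, mul_assoc]⟩

@[simp]
theorem incl_apply (h : Ω₁ ≤ Ω₂) (φ : 𝓓(Ω₁, 𝕜)) (x : Fin d → ℝ) : incl h φ x = φ x := rfl

@[simp]
theorem dilate_apply (y : Fin d → ℝ) (hy : ∀ j, y j ≠ 0) (φ : 𝓓(dilationHull Ω, 𝕜))
    (x : Fin d → ℝ) : dilate y hy φ x = φ (x * y) := rfl

theorem dilate_eq_scale (a : (Fin d → ℝ)ˣ) (φ : 𝓓(dilationHull Ω, 𝕜)) :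
    dilate a (units_apply_ne_zero a) φ = scale a (fun _ ↦ mem_dilationHull_of_mul_mem a) φ := by
  ext x
  rw [dilate_apply, scale_apply, mul_comm]

theorem exists_mem_forall_ne_zero (hΩ : (Ω : Set (Fin d → ℝ)).Nonempty) :
    ∃ z ∈ Ω, ∀ j, z j ≠ 0 := by
  have hd : Dense (univ.pi fun _ : Fin d ↦ ({0}ᶜ : Set ℝ)) :=
    dense_pi _ fun _ _ ↦ dense_compl_singleton 0
  obtain ⟨z, hz, hz'⟩ := hd.inter_open_nonempty _ Ω.isOpen hΩ
  exact ⟨z, hz, fun j ↦ hz' j (mem_univ j)⟩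

theorem nonzeroCoords_le_dilationHull (hΩ : (Ω : Set (Fin d → ℝ)).Nonempty) :
    nonzeroCoords d ≤ dilationHull Ω := by
  intro x hx
  obtain ⟨z, hz, hz0⟩ := exists_mem_forall_ne_zero hΩ
  obtain ⟨a, rfl⟩ := exists_units_coe_eq hx
  obtain ⟨b, rfl⟩ := exists_units_coe_eq hz0
  exact mem_dilationHull_iff_exists_units.2 ⟨b * a⁻¹, by simpa using hz⟩

theorem integral_units_mul (a : (Fin d → ℝ)ˣ) (f : (Fin d → ℝ) → 𝕜) :
    ∫ x, f (a * x) = |∏ j, (a : Fin d → ℝ) j|⁻¹ • ∫ x, f x := by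
  have hdet : (Matrix.diagonal (a : Fin d → ℝ)).det ≠ 0 := by
    rw [Matrix.det_diagonal]
    exact Finset.prod_ne_zero_iff.2 fun j _ ↦ units_apply_ne_zero a j
  have hmul : ⇑(Matrix.toLin' (Matrix.diagonal (a : Fin d → ℝ))) =
      ContinuousLinearEquiv.smulLeft (R₁ := ℝ) a := by
    ext x i
    simp [Matrix.mulVec_diagonal, Units.smul_def]
  have hmap := Real.map_matrix_volume_pi_eq_smul_volume_pi hdet
  rw [hmul, Matrix.det_diagonal] at hmap
  calc ∫ x, f (a * x)
      = ∫ x, f x ∂(volume.map (ContinuousLinearEquiv.smulLeft (R₁ := ℝ) a)) :=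
        ((ContinuousLinearEquiv.smulLeft (R₁ := ℝ) a).toHomeomorph.measurableEmbedding.integral_map
          f).symm
    _ = |∏ j, (a : Fin d → ℝ) j|⁻¹ • ∫ x, f x := by
        rw [hmap, integral_smul_measure, ENNReal.toReal_ofReal (abs_nonneg _), abs_inv]

theorem monomial_mul (α : Fin d → ℕ) (x y : Fin d → ℝ) :
    monomial 𝕜 α (x * y) = monomial 𝕜 α x * monomial 𝕜 α y := by
  simp only [monomial, Pi.mul_apply, mul_pow, Finset.prod_mul_distrib, RCLike.ofReal_mul]

theorem monomialDistr_scale (a : (Fin d → ℝ)ˣ) (h : ∀ x, (a : Fin d → ℝ) * x ∈ Ω₁ → x ∈ Ω₂)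
    (φ : 𝓓(Ω₁, 𝕜)) (α : Fin d → ℕ) :
    monomialDistr 𝕜 Ω₂ α (scale a h φ) = |∏ j, (a : Fin d → ℝ) j|⁻¹ •
      (monomial 𝕜 α (↑a⁻¹ : Fin d → ℝ) * monomialDistr 𝕜 Ω₁ α φ) := by
  rw [monomialDistr_apply, monomialDistr_apply, ← integral_const_mul, ← integral_units_mul]
  congr! 2 with x
  rw [scale_apply, mul_left_comm, ← monomial_mul, Units.inv_mul_cancel_left]

end Dilation

section Moments

variable {𝕜 : Type*} [RCLike 𝕜] {d : ℕ} {Ω Ω₁ Ω₂ : Opens (Fin d → ℝ)}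

theorem integrable_monomial_mul {f : (Fin d → ℝ) → 𝕜} (hf : Continuous f)
    (hs : HasCompactSupport f) (α : Fin d → ℕ) : Integrable fun ξ ↦ monomial 𝕜 α ξ * f ξ :=
  ((continuous_monomial 𝕜 α).mul hf).integrable_of_hasCompactSupport hs.mul_left

theorem integral_eval_smul_eq_zero {f : (Fin d → ℝ) → 𝕜} (hf : Continuous f)
    (hs : HasCompactSupport f) (h : ∀ α, ∫ ξ, monomial 𝕜 α ξ * f ξ = 0)
    (p : MvPolynomial (Fin d) ℝ) : ∫ ξ, MvPolynomial.eval ξ p • f ξ = 0 := by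
  have heval (ξ : Fin d → ℝ) : MvPolynomial.eval ξ p • f ξ =
      ∑ α ∈ p.support, p.coeff α • (monomial 𝕜 α ξ * f ξ) := by
    rw [MvPolynomial.eval_eq', Finset.sum_smul]
    refine Finset.sum_congr rfl fun α _ ↦ ?_
    rw [mul_smul, monomial, ← RCLike.real_smul_eq_coe_mul]
  simp_rw [heval]
  rw [integral_finsetSum p.support fun α _ ↦
    (integrable_monomial_mul hf hs α).fun_smul (p.coeff α)]
  exact Finset.sum_eq_zero fun α _ ↦ by rw [integral_smul, h, smul_zero]

theorem exists_mvPolynomial_norm_sub_eval_le {σ : Type*} {K : Set (σ → ℝ)} (hK : IsCompact K)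
    {g : (σ → ℝ) → ℝ} (hg : Continuous g) {ε : ℝ} (hε : 0 < ε) :
    ∃ p : MvPolynomial σ ℝ, ∀ x ∈ K, ‖g x - MvPolynomial.eval x p‖ ≤ ε := by
  let c (i : σ) : C(σ → ℝ, ℝ) := ⟨fun x ↦ x i, by fun_prop⟩
  have hc (p : MvPolynomial σ ℝ) (x : σ → ℝ) :
      MvPolynomial.aeval c p x = MvPolynomial.eval x p := by
    induction p using MvPolynomial.induction_on with
    | C a => simp
    | add p q hp hq => simp [hp, hq]
    | mul_X p i hp => simp [hp, c]
  have hsep : (MvPolynomial.aeval (R := ℝ) c).range.SeparatesPoints := by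
    intro x y hxy
    obtain ⟨i, hi⟩ := Function.ne_iff.1 hxy
    exact ⟨c i, ⟨c i, ⟨MvPolynomial.X i, by simp⟩, rfl⟩, hi⟩
  obtain ⟨_, ⟨p, rfl⟩, hp⟩ :=
    ContinuousMap.exists_mem_subalgebra_near_continuous_of_isCompact_of_separatesPoints hsep
      ⟨g, hg⟩ hK hε
  refine ⟨p, fun x hx ↦ ?_⟩
  rw [norm_sub_rev]
  simpa [hc] using (hp x hx).le

theorem eq_zero_of_forall_integral_monomial_mul_eq_zero {f : (Fin d → ℝ) → 𝕜} (hf : Continuous f)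
    (hs : HasCompactSupport f) (h : ∀ α, ∫ ξ, monomial 𝕜 α ξ * f ξ = 0) : f = 0 := by
  have hsmul {g : (Fin d → ℝ) → ℝ} (hg : Continuous g) : Integrable fun x ↦ g x • f x :=
    (hg.smul hf).integrable_of_hasCompactSupport hs.smul_left
  have hbound {g : (Fin d → ℝ) → ℝ} (hg : Continuous g) {ε : ℝ} (hε : 0 < ε) :
      ‖∫ x, g x • f x‖ ≤ ε * ∫ x, ‖f x‖ := by
    obtain ⟨p, hp⟩ := exists_mvPolynomial_norm_sub_eval_le hs hg hε
    rw [← sub_zero (∫ x, g x • f x), ← integral_eval_smul_eq_zero hf hs h p,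
      ← integral_sub (hsmul hg) (hsmul p.continuous_eval), ← integral_const_mul]
    refine norm_integral_le_of_norm_le ((hf.integrable_of_hasCompactSupport hs).norm.const_mul ε)
      (ae_of_all _ fun x ↦ ?_)
    rw [← sub_smul, norm_smul]
    by_cases hx : x ∈ tsupport f
    · gcongr
      exact hp x hx
    · simp [image_eq_zero_of_notMem_tsupport hx]
  have hzero {g : (Fin d → ℝ) → ℝ} (hg : Continuous g) : ∫ x, g x • f x = 0 := by
    have hlim : Tendsto (fun ε : ℝ ↦ ε * ∫ x, ‖f x‖) (𝓝[>] 0) (𝓝 0) :=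
      ((continuous_mul_const _).tendsto' 0 0 (zero_mul _)).mono_left nhdsWithin_le_nhds
    exact norm_le_zero_iff.1
      (ge_of_tendsto hlim (eventually_nhdsWithin_of_forall fun ε hε ↦ hbound hg hε))
  exact (hf.ae_eq_iff_eq volume continuous_zero).1
    (ae_eq_zero_of_integral_contDiff_smul_eq_zero hf.locallyIntegrable fun g hg _ ↦
      hzero hg.continuous)

theorem eq_of_forall_monomialDistr_eq {φ : 𝓓(Ω₁, 𝕜)} {ψ : 𝓓(Ω₂, 𝕜)}
    (h : ∀ α, monomialDistr 𝕜 Ω₁ α φ = monomialDistr 𝕜 Ω₂ α ψ) : (φ : (Fin d → ℝ) → 𝕜) = ψ := by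
  refine sub_eq_zero.1 (eq_zero_of_forall_integral_monomial_mul_eq_zero
    (φ.continuous.sub ψ.continuous) (φ.hasCompactSupport.sub ψ.hasCompactSupport) fun α ↦ ?_)
  simp only [Pi.sub_apply, mul_sub]
  rw [integral_sub (integrable_monomial_mul φ.continuous φ.hasCompactSupport α)
    (integrable_monomial_mul ψ.continuous ψ.hasCompactSupport α), sub_eq_zero]
  simpa only [monomialDistr_apply, mul_comm] using h α

/-- The moments of `ψ` are those of `φ`, multiplied by the family `m`. For test functions on `ℝ^d`
this says that `(φ, ψ)` lies in `momentGraph m`; here each of the two may live on its own open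
set. -/
def MomentRel (m : (Fin d → ℕ) → 𝕜) (φ : 𝓓(Ω₁, 𝕜)) (ψ : 𝓓(Ω₂, 𝕜)) : Prop :=
  ∀ α, monomialDistr 𝕜 Ω₂ α ψ = m α * monomialDistr 𝕜 Ω₁ α φ

variable {m : (Fin d → ℕ) → 𝕜}

theorem mem_momentGraph_iff_momentRel {φ ψ : 𝓓((⊤ : Opens (Fin d → ℝ)), 𝕜)} :
    (φ, ψ) ∈ momentGraph m ↔ MomentRel m φ ψ := by
  refine forall_congr' fun α ↦ ?_
  have hsplit (ξ : Fin d → ℝ) : monomial 𝕜 α ξ * (m α * φ ξ - ψ ξ) =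
      m α * (monomial 𝕜 α ξ * φ ξ) - monomial 𝕜 α ξ * ψ ξ := by ring
  simp only [hsplit]
  rw [integral_sub ((integrable_monomial_mul φ.continuous φ.hasCompactSupport α).const_mul _)
      (integrable_monomial_mul ψ.continuous ψ.hasCompactSupport α),
    integral_const_mul, sub_eq_zero, eq_comm]
  simp only [monomialDistr_apply, mul_comm]

theorem momentRel_incl_iff {Ω₁' Ω₂' : Opens (Fin d → ℝ)} {h₁ : Ω₁ ≤ Ω₁'} {h₂ : Ω₂ ≤ Ω₂'}
    {φ : 𝓓(Ω₁, 𝕜)} {ψ : 𝓓(Ω₂, 𝕜)} :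
    MomentRel m (incl h₁ φ) (incl h₂ ψ) ↔ MomentRel m φ ψ := by
  simp only [MomentRel, monomialDistr_apply, incl_apply]

theorem MomentRel.unique {Ω₂' : Opens (Fin d → ℝ)} {φ : 𝓓(Ω₁, 𝕜)} {ψ : 𝓓(Ω₂, 𝕜)}
    {ψ' : 𝓓(Ω₂', 𝕜)} (h : MomentRel m φ ψ) (h' : MomentRel m φ ψ') :
    (ψ : (Fin d → ℝ) → 𝕜) = ψ' :=
  eq_of_forall_monomialDistr_eq fun α ↦ (h α).trans (h' α).symm

theorem MomentRel.sum {ι : Type*} {t : Finset ι} {φ : ι → 𝓓(Ω₁, 𝕜)} {ψ : ι → 𝓓(Ω₂, 𝕜)}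
    (h : ∀ i ∈ t, MomentRel m (φ i) (ψ i)) : MomentRel m (∑ i ∈ t, φ i) (∑ i ∈ t, ψ i) := by
  intro α
  have h₁ := map_sum (monomialDistr 𝕜 Ω₁ α) φ t
  have h₂ := map_sum (monomialDistr 𝕜 Ω₂ α) ψ t
  rw [h₁, h₂, Finset.mul_sum]
  exact Finset.sum_congr rfl fun i hi ↦ h i hi α

theorem MomentRel.scale {Ω₁' Ω₂' : Opens (Fin d → ℝ)} {φ : 𝓓(Ω₁, 𝕜)} {ψ : 𝓓(Ω₂, 𝕜)}
    (h : MomentRel m φ ψ) (a : (Fin d → ℝ)ˣ) (h₁ : ∀ x, (a : Fin d → ℝ) * x ∈ Ω₁ → x ∈ Ω₁')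
    (h₂ : ∀ x, (a : Fin d → ℝ) * x ∈ Ω₂ → x ∈ Ω₂') :
    MomentRel m (scale a h₁ φ) (scale a h₂ ψ) := by
  intro α
  rw [monomialDistr_scale, monomialDistr_scale, h α, mul_smul_comm, mul_left_comm]

theorem IsTranspose.momentRel {L : Distr 𝕜 Ω →L[𝕜] Distr 𝕜 Ω} {M : 𝓓(Ω, 𝕜) →L[𝕜] 𝓓(Ω, 𝕜)}
    (hM : IsTranspose L M) (hL : IsHadamardOperator L m) (φ : 𝓓(Ω, 𝕜)) : MomentRel m φ (M φ) := by
  intro α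
  have hα : L (monomialDistr 𝕜 Ω α) = m α • monomialDistr 𝕜 Ω α := (hL α).apply_eq_smul
  rw [← hM, hα]
  rfl

end Moments

section Transpose

variable {𝕜 : Type*} [RCLike 𝕜] {d : ℕ} {Ω : Opens (Fin d → ℝ)}

variable (𝕜 Ω) in
/-- Evaluation at the point `x`, as a distribution on `Ω`. -/
def evalDistr (x : Fin d → ℝ) : Distr 𝕜 Ω :=
  UniformConvergenceCLM.ofFun (RingHom.id 𝕜) 𝕜 _
    ((BoundedContinuousFunction.evalCLM 𝕜 x).comp (TestFunction.toBoundedContinuousFunctionCLM 𝕜))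

theorem exists_forall_apply_eq_apply (L : Distr 𝕜 Ω →L[𝕜] Distr 𝕜 Ω) (φ : 𝓓(Ω, 𝕜)) :
    ∃ ψ : 𝓓(Ω, 𝕜), ∀ S, L S φ = S ψ :=
  exists_forall_eq_apply_of_compactConvergence
    (fun _ ↦ exists_isCompact_convex_balanced_superset_testFunction)
    { toFun S := L S φ
      map_add' S S' := by rw [map_add]; rfl
      map_smul' c S := by rw [map_smul]; rfl
      cont := (continuous_eval_const φ).comp L.continuous }

theorem exists_isTranspose (L : Distr 𝕜 Ω →L[𝕜] Distr 𝕜 Ω) :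
    ∃ M : 𝓓(Ω, 𝕜) →L[𝕜] 𝓓(Ω, 𝕜), IsTranspose L M := by
  choose M hM using exists_forall_apply_eq_apply L
  have hMx (φ x) : M φ x = L (evalDistr 𝕜 Ω x) φ := (hM φ (evalDistr 𝕜 Ω x)).symm
  let N : 𝓓(Ω, 𝕜) →ₗ[𝕜] 𝓓(Ω, 𝕜) :=
    { toFun := M
      map_add' φ ψ := by ext x; simp [hMx]
      map_smul' c φ := by ext x; simp [hMx] }
  refine ⟨⟨N, (TestFunction.continuous_iff_continuous_comp N).2 fun K hK ↦ ?_⟩, fun S φ ↦ hM φ S⟩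
  refine continuous_of_forall_dual_comp
    (N ∘ₗ (TestFunction.ofSupportedInCLM 𝕜 (F := 𝕜) (n := ⊤) hK).toLinearMap) fun S ↦ ?_
  exact ((L S).continuous.comp (TestFunction.continuous_ofSupportedIn hK)).congr fun f ↦ hM _ S

end Transpose

section Extension

variable {𝕜 : Type*} [RCLike 𝕜] {d : ℕ} {Ω : Opens (Fin d → ℝ)} {m : (Fin d → ℕ) → 𝕜}
  {M : 𝓓(Ω, 𝕜) →L[𝕜] 𝓓(Ω, 𝕜)}

/-- The dilated open set `a⁻¹ Ω`. -/
def dilatedOpens (a : (Fin d → ℝ)ˣ) (Ω : Opens (Fin d → ℝ)) : Opens (Fin d → ℝ) :=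
  ⟨{x | (a : Fin d → ℝ) * x ∈ Ω}, Ω.isOpen.preimage (continuous_const_mul _)⟩

theorem exists_momentRel_of_tsupport_subset (hM : ∀ φ, MomentRel m φ (M φ))
    (K : Compacts (Fin d → ℝ)) (hK : (K : Set (Fin d → ℝ)) ⊆ dilationHull Ω) :
    ∃ N : 𝓓(dilationHull Ω, 𝕜) →L[𝕜] 𝓓(dilationHull Ω, 𝕜),
      ∀ φ : 𝓓(dilationHull Ω, 𝕜), tsupport φ ⊆ K → MomentRel m φ (N φ) := by
  obtain ⟨t, χ, hχ⟩ := exists_testFunction_sum_eq_one (𝕜 := 𝕜) K.isCompact (dilatedOpens · Ω)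
    fun x hx ↦ mem_iUnion.2 (mem_dilationHull_iff_exists_units.1 (hK hx))
  have hmem (a : (Fin d → ℝ)ˣ) (x) (hx : (a : Fin d → ℝ) * x ∈ Ω) : x ∈ dilationHull Ω :=
    mem_dilationHull_iff_exists_units.2 ⟨a, hx⟩
  let contract (a : (Fin d → ℝ)ˣ) : 𝓓(dilatedOpens a Ω, 𝕜) →L[𝕜] 𝓓(Ω, 𝕜) :=
    scale a⁻¹ fun x hx ↦ by simpa [dilatedOpens] using hx
  let expand (a : (Fin d → ℝ)ˣ) : 𝓓(Ω, 𝕜) →L[𝕜] 𝓓(dilationHull Ω, 𝕜) :=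
    scale a (hmem a)
  refine ⟨∑ a ∈ t, (expand a).comp (M.comp ((contract a).comp (mulCLM (χ a)))), fun φ hφ ↦ ?_⟩
  have hsum : ∑ a ∈ t, expand a (contract a (mulCLM (χ a) φ)) = φ := by
    ext x
    by_cases hx : x ∈ tsupport φ
    · simp [expand, contract, ← Finset.mul_sum, hχ x (hφ hx)]
    · simp [expand, contract, image_eq_zero_of_notMem_tsupport hx]
  have hrel : MomentRel m (∑ a ∈ t, expand a (contract a (mulCLM (χ a) φ)))
      (∑ a ∈ t, expand a (M (contract a (mulCLM (χ a) φ)))) :=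
    MomentRel.sum fun a _ ↦ (hM (contract a (mulCLM (χ a) φ))).scale a (hmem a) (hmem a)
  rw [hsum] at hrel
  rw [sum_apply]
  exact hrel

theorem exists_momentRel_dilationHull (hM : ∀ φ, MomentRel m φ (M φ)) :
    ∃ Mt : 𝓓(dilationHull Ω, 𝕜) →L[𝕜] 𝓓(dilationHull Ω, 𝕜), ∀ φ, MomentRel m φ (Mt φ) := by
  choose N hN using exists_momentRel_of_tsupport_subset hM
  let supp (φ : 𝓓(dilationHull Ω, 𝕜)) : Compacts (Fin d → ℝ) := ⟨tsupport φ, φ.hasCompactSupport⟩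
  have hMt (φ) : MomentRel m φ (N (supp φ) φ.tsupport_subset φ) := hN _ _ φ subset_rfl
  exact ⟨TestFunction.limitCLM 𝕜 (fun φ ↦ N (supp φ) φ.tsupport_subset φ)
    (fun K hK ↦ (N K hK).comp (TestFunction.ofSupportedInCLM 𝕜 hK))
    fun K hK f ↦ DFunLike.coe_injective ((hMt _).unique (hN K hK _ f.tsupport_subset)), hMt⟩

variable {Mt : 𝓓(dilationHull Ω, 𝕜) →L[𝕜] 𝓓(dilationHull Ω, 𝕜)}

theorem map_incl_of_forall_momentRel (hM : ∀ φ, MomentRel m φ (M φ))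
    (hMt : ∀ φ, MomentRel m φ (Mt φ)) (φ : 𝓓(Ω, 𝕜)) :
    Mt (incl (le_dilationHull Ω) φ) = incl (le_dilationHull Ω) (M φ) :=
  DFunLike.coe_injective ((hMt _).unique (momentRel_incl_iff.2 (hM φ)))

theorem incl_mem_momentGraph_iff_of_forall_momentRel (hMt : ∀ φ, MomentRel m φ (Mt φ))
    (φ : 𝓓(dilationHull Ω, 𝕜)) (ψ : 𝓓((⊤ : Opens (Fin d → ℝ)), 𝕜)) :
    (incl le_top φ, ψ) ∈ momentGraph m ↔ ψ = incl le_top (Mt φ) := by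
  have hφ : MomentRel m (incl le_top φ) (incl le_top (Mt φ)) := momentRel_incl_iff.2 (hMt φ)
  rw [mem_momentGraph_iff_momentRel]
  exact ⟨fun h ↦ DFunLike.coe_injective (h.unique hφ), fun h ↦ h ▸ hφ⟩

theorem map_dilate_of_forall_momentRel (hMt : ∀ φ, MomentRel m φ (Mt φ)) (y : Fin d → ℝ)
    (hy : ∀ j, y j ≠ 0) (φ : 𝓓(dilationHull Ω, 𝕜)) :
    Mt (dilate y hy φ) = dilate y hy (Mt φ) := by
  obtain ⟨a, rfl⟩ := exists_units_coe_eq hy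
  rw [dilate_eq_scale, dilate_eq_scale]
  exact DFunLike.coe_injective ((hMt _).unique ((hMt φ).scale a _ _))

theorem exists_distr_forall_apply_eq (hMt : ∀ φ, MomentRel m φ (Mt φ)) :
    ∃ T : Distr 𝕜 (dilationHull Ω), ∀ φ y (hy : ∀ j, y j ≠ 0), Mt φ y = T (dilate y hy φ) := by
  refine ⟨UniformConvergenceCLM.ofFun (RingHom.id 𝕜) 𝕜 _
    (((UniformConvergenceCLM.ofFun (RingHom.id 𝕜) 𝕜 _).symm (evalDistr 𝕜 _ 1)).comp Mt),
    fun φ y hy ↦ ?_⟩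
  change Mt φ y = Mt (dilate y hy φ) 1
  rw [map_dilate_of_forall_momentRel hMt, dilate_apply, one_mul]

end Extension

section Support

variable {d : ℕ} {Ω : Opens (Fin d → ℝ)}

theorem isOpen_compl_W (ε : ℝ) : IsOpen (W d ε)ᶜ := by
  have : (W d ε)ᶜ = ⋃ j, {x | |x j| < ε} := by ext x; simp [W]
  rw [this]
  exact isOpen_iUnion fun j ↦ isOpen_lt (by fun_prop) continuous_const

theorem exists_units_mul_mem_of_apply_eq_zero {w : Fin d → ℝ} (hw : w ∈ dilationHull Ω)
    {j : Fin d} (hj : w j = 0) (R : (Fin d → ℝ) → ℝ) :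
    ∃ a : (Fin d → ℝ)ˣ, ↑a * w ∈ Ω ∧ R (a * w) < ‖(a : Fin d → ℝ)‖ := by
  obtain ⟨b, hb⟩ := mem_dilationHull_iff_exists_units.1 hw
  let y : Fin d → ℝ := Function.update b j (|R (b * w)| + 1)
  have hyj : y j = |R (b * w)| + 1 := Function.update_self ..
  have hyi {i} (hi : i ≠ j) : y i = (b : Fin d → ℝ) i := Function.update_of_ne hi ..
  have hyw : y * w = b * w := by
    ext i
    by_cases hi : i = j
    · simp [hi, hj]
    · simp [hyi hi]
  obtain ⟨a, ha⟩ : ∃ a : (Fin d → ℝ)ˣ, ↑a = y := exists_units_coe_eq fun i ↦ by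
    by_cases hi : i = j
    · rw [hi, hyj]
      positivity
    · exact hyi hi ▸ units_apply_ne_zero b i
  refine ⟨a, by rwa [ha, hyw], ?_⟩
  calc R (a * w) = R (b * w) := by rw [ha, hyw]
    _ < y j := by rw [hyj]; linarith [le_abs_self (R (b * w))]
    _ ≤ ‖(a : Fin d → ℝ)‖ := by
      rw [ha]
      exact (le_abs_self _).trans (norm_le_pi_norm y j)

theorem exists_pos_forall_abs_lt_imp_lt_norm (z : (Fin d → ℝ)ˣ) (r : ℝ) :
    ∃ ε > 0, ∀ w : (Fin d → ℝ)ˣ, ∀ j, |(w : Fin d → ℝ) j| < ε →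
      r < ‖((z * w⁻¹ : (Fin d → ℝ)ˣ) : Fin d → ℝ)‖ := by
  obtain ⟨δ, hδ, hδz⟩ : ∃ δ > 0, ∀ j, δ < |(z : Fin d → ℝ) j| := by
    simpa using Pi.exists_forall_pos_add_lt (x := fun _ : Fin d ↦ 0)
      (y := fun j ↦ |(z : Fin d → ℝ) j|) fun j ↦ abs_pos.2 (units_apply_ne_zero z j)
  refine ⟨δ / (|r| + 1), by positivity, fun w j hj ↦ ?_⟩
  have hw : 0 < |(w : Fin d → ℝ) j| := abs_pos.2 (units_apply_ne_zero w j)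
  have hinv : ((w⁻¹ : (Fin d → ℝ)ˣ) : Fin d → ℝ) j = ((w : Fin d → ℝ) j)⁻¹ :=
    eq_inv_of_mul_eq_one_left (congrFun w.inv_mul j)
  calc r < |r| + 1 := by linarith [le_abs_self r]
    _ ≤ |(z : Fin d → ℝ) j| / |(w : Fin d → ℝ) j| := by
      rw [le_div_iff₀ hw, ← le_div_iff₀' (by positivity)]
      exact hj.le.trans (by gcongr; exact (hδz j).le)
    _ = ‖((z * w⁻¹ : (Fin d → ℝ)ˣ) : Fin d → ℝ) j‖ := by
      rw [Units.val_mul, Pi.mul_apply, hinv, Real.norm_eq_abs, abs_mul, abs_inv, div_eq_mul_inv]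
    _ ≤ _ := norm_le_pi_norm _ j

/-- On a coordinate hyperplane the corresponding factor of the dilation is free; off all of them,
the point is moved to a fixed point of `Ω` with non-zero coordinates. -/
theorem exists_pos_forall_notMem_W (hΩ : (Ω : Set (Fin d → ℝ)).Nonempty) (R : (Fin d → ℝ) → ℝ) :
    ∃ ε > 0, ∀ w ∈ dilationHull Ω, w ∉ W d ε →
      ∃ a : (Fin d → ℝ)ˣ, ↑a * w ∈ Ω ∧ R (a * w) < ‖(a : Fin d → ℝ)‖ := by
  obtain ⟨z, hz, hz0⟩ := exists_mem_forall_ne_zero hΩ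
  obtain ⟨z, rfl⟩ := exists_units_coe_eq hz0
  obtain ⟨ε, hε, h⟩ := exists_pos_forall_abs_lt_imp_lt_norm z (R z)
  refine ⟨ε, hε, fun w hw hwW ↦ ?_⟩
  by_cases hw0 : ∀ j, w j ≠ 0
  · obtain ⟨w, rfl⟩ := exists_units_coe_eq hw0
    obtain ⟨j, hj⟩ : ∃ j, |(w : Fin d → ℝ) j| < ε := by simpa [W] using hwW
    have hzw : ((z * w⁻¹ : (Fin d → ℝ)ˣ) : Fin d → ℝ) * w = z := by simp [mul_assoc]
    exact ⟨z * w⁻¹, by rwa [hzw], by rw [hzw]; exact h w j hj⟩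
  · push Not at hw0
    obtain ⟨j, hj⟩ := hw0
    exact exists_units_mul_mem_of_apply_eq_zero hw hj R

variable {𝕜 : Type*} [RCLike 𝕜] {M : 𝓓(Ω, 𝕜) →L[𝕜] 𝓓(Ω, 𝕜)}
  {Mt : 𝓓(dilationHull Ω, 𝕜) → 𝓓(dilationHull Ω, 𝕜)} {T : Distr 𝕜 (dilationHull Ω)}

theorem exists_isVanishingOn_preimage
    (hext : ∀ φ : 𝓓(Ω, 𝕜), Mt (incl (le_dilationHull Ω) φ) = incl (le_dilationHull Ω) (M φ))
    (hT : ∀ φ y (hy : ∀ j, y j ≠ 0), Mt φ y = T (dilate y hy φ)) {z : Fin d → ℝ} (hz : z ∈ Ω) :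
    ∃ (R : ℝ) (V : Set (Fin d → ℝ)), IsOpen V ∧ z ∈ V ∧ ∀ a : (Fin d → ℝ)ˣ,
      R < ‖(a : Fin d → ℝ)‖ → Distribution.IsVanishingOn T (((a : Fin d → ℝ) * ·) ⁻¹' V) := by
  obtain ⟨C, hC, hzC, hCΩ⟩ := exists_compact_subset Ω.isOpen hz
  let C' : Compacts (Fin d → ℝ) := ⟨C, hC⟩
  obtain ⟨K, -, hK⟩ := exists_compacts_tsupport_subset_of_baireSpace
    ((M.comp (TestFunction.ofSupportedInCLM 𝕜 (K := C') hCΩ)).restrictScalars ℝ)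
  obtain ⟨R, hR⟩ := K.isCompact.isBounded.exists_norm_le
  refine ⟨R, interior C, isOpen_interior, hzC, fun a ha φ hφ ↦ ?_⟩
  let φ' : 𝓓(dilationHull Ω, 𝕜) := scale a⁻¹ (fun _ ↦ mem_dilationHull_of_mul_mem a⁻¹) φ
  have hφ' : dilate a (units_apply_ne_zero a) φ' = φ := by
    rw [dilate_eq_scale]
    ext x
    simp [φ']
  have hsupp : tsupport φ' ⊆ C := fun x hx ↦ by
    have hx' : (a⁻¹ : (Fin d → ℝ)ˣ) * x ∈ tsupport φ :=
      tsupport_comp_subset_preimage φ (continuous_const_mul _) hx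
    simpa using interior_subset (hφ hx')
  let f : 𝓓_{C'}(Fin d → ℝ, 𝕜) :=
    .of_support_subset φ'.contDiff ((subset_tsupport φ').trans hsupp)
  have hf : φ' = incl (le_dilationHull Ω) (TestFunction.ofSupportedIn hCΩ f) := rfl
  calc T φ = Mt φ' a := by rw [hT φ' a (units_apply_ne_zero a), hφ']
    _ = M (TestFunction.ofSupportedIn hCΩ f) a := by rw [hf, hext, incl_apply]
    _ = 0 := image_eq_zero_of_notMem_tsupport fun h ↦ ha.not_ge (hR _ (hK f h))

theorem exists_dsupport_subset_W (hΩ : (Ω : Set (Fin d → ℝ)).Nonempty)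
    (hext : ∀ φ : 𝓓(Ω, 𝕜), Mt (incl (le_dilationHull Ω) φ) = incl (le_dilationHull Ω) (M φ))
    (hT : ∀ φ y (hy : ∀ j, y j ≠ 0), Mt φ y = T (dilate y hy φ)) :
    ∃ ε : ℝ, 0 < ε ∧ Distribution.dsupport T ⊆ W d ε := by
  choose! R V hVo hzV hV using fun z (hz : z ∈ Ω) ↦ exists_isVanishingOn_preimage hext hT hz
  obtain ⟨ε, hε, h⟩ := exists_pos_forall_notMem_W hΩ R
  have hlocal (w : Fin d → ℝ) (hw : w ∈ dilationHull Ω) (hwW : w ∉ W d ε) :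
      ∃ s, IsOpen s ∧ w ∈ s ∧ Distribution.IsVanishingOn T s := by
    obtain ⟨a, haw, hRa⟩ := h w hw hwW
    exact ⟨_, (hVo _ haw).preimage (continuous_const_mul (a : Fin d → ℝ)), hzV _ haw,
      hV _ haw a hRa⟩
  have hvanish : Distribution.IsVanishingOn T (W d ε)ᶜ := fun φ hφ ↦
    apply_eq_zero_of_forall_isVanishingOn T fun x hx ↦
      hlocal x (φ.tsupport_subset hx) (hφ hx)
  refine ⟨ε, hε, fun w hw ↦ ?_⟩
  by_contra hwW
  exact (Distribution.notMem_dsupport_iff w).2 ⟨_, hvanish, isOpen_compl_W ε, hwW⟩ hw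

end Support

end Hadamard

end

/-- A Hadamard operator `L` on `𝓓'(Ω)` with eigenvalues `m` has a transpose `M` on `𝓓(Ω)`; the
operator `Mt` with graph `momentGraph m` is everywhere defined on `𝓓(dilationHull Ω)`, maps this
space continuously into itself and extends `M`; and `Mt`, hence also `M`, is represented by a
distribution `T` whose support has positive distance to all coordinate hyperplanes. -/
theorem proposition3p2 {𝕜 : Type*} [RCLike 𝕜] {d : ℕ} (Ω : Opens (Fin d → ℝ))
    (hΩ : (Ω : Set (Fin d → ℝ)).Nonempty)
    (L : Hadamard.Distr 𝕜 Ω →L[𝕜] Hadamard.Distr 𝕜 Ω) (m : (Fin d → ℕ) → 𝕜)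
    (hL : Hadamard.IsHadamardOperator L m) :
    ∃ (M : 𝓓(Ω, 𝕜) →L[𝕜] 𝓓(Ω, 𝕜))
      (Mt : 𝓓(Hadamard.dilationHull Ω, 𝕜) →L[𝕜] 𝓓(Hadamard.dilationHull Ω, 𝕜)),
      Hadamard.IsTranspose L M ∧
      (∀ (φ : 𝓓(Hadamard.dilationHull Ω, 𝕜)) (ψ : 𝓓((⊤ : Opens (Fin d → ℝ)), 𝕜)),
        (Hadamard.incl le_top φ, ψ) ∈ Hadamard.momentGraph m ↔
          ψ = Hadamard.incl le_top (Mt φ)) ∧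
      (∀ φ : 𝓓(Ω, 𝕜), Mt (Hadamard.incl (Hadamard.le_dilationHull Ω) φ) =
        Hadamard.incl (Hadamard.le_dilationHull Ω) (M φ)) ∧
      ∃ (T : Hadamard.Distr 𝕜 (Hadamard.dilationHull Ω)) (ε : ℝ), 0 < ε ∧
        Distribution.dsupport T ⊆ Hadamard.W d ε ∧
        (∀ (φ : 𝓓(Hadamard.dilationHull Ω, 𝕜)) (y : Fin d → ℝ) (hy : ∀ j, y j ≠ 0),
          Mt φ y = T (Hadamard.dilate y hy φ)) ∧
        (∃ h : Hadamard.nonzeroCoords d ≤ Hadamard.dilationHull Ω,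
          ∀ (φ : 𝓓(Hadamard.nonzeroCoords d, 𝕜)) (y : Fin d → ℝ) (hy : ∀ j, y j ≠ 0),
            Mt (Hadamard.incl h φ) y = T (Hadamard.dilate y hy (Hadamard.incl h φ))) ∧
        (∀ (φ : 𝓓(Ω, 𝕜)) (y : Fin d → ℝ) (hy : ∀ j, y j ≠ 0),
          M φ y =
            T (Hadamard.dilate y hy (Hadamard.incl (Hadamard.le_dilationHull Ω) φ))) := by
  obtain ⟨M, hM⟩ := Hadamard.exists_isTranspose L
  have hMm := hM.momentRel hL
  obtain ⟨Mt, hMt⟩ := Hadamard.exists_momentRel_dilationHull hMm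
  have hext := Hadamard.map_incl_of_forall_momentRel hMm hMt
  obtain ⟨T, hT⟩ := Hadamard.exists_distr_forall_apply_eq hMt
  obtain ⟨ε, hε, hsupp⟩ := Hadamard.exists_dsupport_subset_W hΩ hext hT
  refine ⟨M, Mt, hM, Hadamard.incl_mem_momentGraph_iff_of_forall_momentRel hMt, hext, T, ε, hε,
    hsupp, hT, ⟨Hadamard.nonzeroCoords_le_dilationHull hΩ, fun φ y hy ↦ hT _ y hy⟩,
    fun φ y hy ↦ ?_⟩
  rw [← hT, hext, Hadamard.incl_apply]
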